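/- Let $\Omega$ be a Hausdorff topological space with its Borel $\sigma$-field $\mathfrak B$, and let $\Theta$ be the set of all measures $\mu$ on $(\Omega,\mathfrak B)$ with $\mu(\Omega)<\infty$. The $\tau$-topology on $\Theta$ is the coarsest topology for which $\mu\mapsto\mu(B)$ is continuous for every $B\in\mathfrak B$; $\mathfrak{cl}_\tau$ denotes closure in $\Theta$ for this topology, and $\Psi\subset\Theta$ is called relatively $\tau$-compact if $\mathfrak{cl}_\tau(\Psi)$ is $\tau$-compact. For $\mu\in\Theta$ and $n\ge 1$ let $\kappa_1,\dots,\kappa_n$ be $n$ independent realizations of the Poisson random process on $\Omega$ with mean measure $\mu$. A test $K_n$ is a $[0,1]$-valued measurable function of $(\kappa_1,\dots,\kappa_n)$ (measurable with respect to the $\sigma$-field generated by the counts $\kappa_i(B)$, $B\in\mathfrak B$), its value being the probability of rejecting $H_0$. For $\Theta_0,\Theta_1\subset\Theta$, the hypothesis $H_0:\mu\in\Theta_0$ is tested against $H_1:\mu\in\Theta_1$; put $$\alpha(K_n)=\sup_{\mu\in\Theta_0}E_\mu[K_n],\qquad \beta(K_n)=\sup_{\mu\in\Theta_1}E_\mu[1-K_n]$$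 (a supremum over the empty set being $0$). $H_0$ and $H_1$ are called distinguishable if for every $a\in(0,1)$ there are tests $K_n$, $n\ge1$, with $\alpha(K_n)<a$ for all $n$ and $\beta(K_n)\to0$ as $n\to\infty$; they are called indistinguishable if $\alpha(K_n)+\beta(K_n)\ge1$ for every $n\ge1$ and every test $K_n$. **Theorem.** Let $\Theta_0,\Theta_1\subset\Theta$. (i) If $\Theta_0$ and $\Theta_1$ are both relatively $\tau$-compact and $\mathfrak{cl}_\tau(\Theta_0)\cap\mathfrak{cl}_\tau(\Theta_1)\neq\emptyset$, then $H_0$ and $H_1$ are indistinguishable. (ii) If $\Theta_0$ or $\Theta_1$ is relatively $\tau$-compact and $\mathfrak{cl}_\tau(\Theta_0)\cap\mathfrak{cl}_\tau(\Theta_1)=\emptyset$, then $H_0$ and $H_1$ are distinguishable. Moreover, there are tests $K_n$ and constants $c>0$ and $n_0$ such that $\alpha(K_n)\le e^{-cn}$ and $\beta(K_n)\le e^{-cn}$ for all $n>n_0$. -/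

import Mathlib

open MeasureTheory Filter Topology

/-- The law of the Poisson random process on `Ω` with finite mean measure `μ`, as a measure on the
space of realizations: `Measure Ω` with the σ-algebra generated by the counts `κ ↦ κ B`, `B`
measurable. The process has `k` atoms with probability `exp (-μ(Ω)) μ(Ω)^k / k!`, and given their
number the atoms are independent with distribution `μ / μ(Ω)`; that is,
`∑ₖ (exp (-μ(Ω)) / k!) • law of (δ_{x₁} + ⋯ + δ_{xₖ})`, where `(x₁, …, xₖ)` runs through `Ωᵏ` under
the (unnormalized) product measure `μ ⊗ ⋯ ⊗ μ`. -/
noncomputable def poissonLaw {Ω : Type*} [MeasurableSpace Ω] (μ : FiniteMeasure Ω) :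
    Measure (Measure Ω) :=
  Measure.sum fun k : ℕ =>
    ENNReal.ofReal (Real.exp (-(μ.mass : ℝ)) / (k.factorial : ℝ)) •
      (Measure.pi fun _ : Fin k => (μ : Measure Ω)).map
        (fun x : Fin k → Ω => ∑ i : Fin k, Measure.dirac (x i))

theorem measurable_sum_dirac {Ω : Type*} [MeasurableSpace Ω] (k : ℕ) :
    Measurable (fun x : Fin k → Ω => ∑ i : Fin k, Measure.dirac (x i)) := by
  refine Measure.measurable_of_measurable_coe _ fun s hs => ?_
  simp only [Measure.finsetSum_apply]
  exact Finset.measurable_sum _ fun i _ =>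
    (Measure.measurable_coe hs).comp (Measure.measurable_dirac.comp (measurable_pi_apply i))

instance {Ω : Type*} [MeasurableSpace Ω] (μ : FiniteMeasure Ω) :
    IsProbabilityMeasure (poissonLaw μ) := by
  constructor
  have h := (ProbabilityTheory.hasSum_one_poissonMeasure μ.mass)
  have h2 : ∑' k : ℕ, ENNReal.ofReal (Real.exp (-(μ.mass : ℝ)) * (μ.mass : ℝ) ^ k /
      (k.factorial : ℝ)) = 1 := by
    rw [← ENNReal.ofReal_tsum_of_nonneg (fun _ => by positivity) h.summable, h.tsum_eq]
    simp
  rw [poissonLaw, Measure.sum_apply _ MeasurableSet.univ, ← h2]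
  congr 1
  ext k
  rw [Measure.smul_apply, Measure.map_apply (measurable_sum_dirac k) MeasurableSet.univ,
    Set.preimage_univ, Measure.pi_univ]
  simp only [Finset.prod_const, Finset.card_univ, Fintype.card_fin, smul_eq_mul]
  rw [← FiniteMeasure.ennreal_mass, ← ENNReal.ofReal_coe_nnreal,
    ← ENNReal.ofReal_pow (by positivity), ← ENNReal.ofReal_mul (by positivity)]
  congr 1
  ring

/-- `poissonLaw μ` is the law of the Poisson process in the usual sense: the numbers of points in
disjoint measurable sets `B j` are independent and Poisson distributed with means `μ (B j)`. -/
theorem map_count_poissonLaw {Ω : Type*} [MeasurableSpace Ω] (μ : FiniteMeasure Ω) {ι : Type*}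
    [Fintype ι] (B : ι → Set Ω) (hB : ∀ j, MeasurableSet (B j))
    (hd : Pairwise fun i j => Disjoint (B i) (B j)) :
    (poissonLaw μ).map (fun κ j => (κ (B j)).toReal) =
      Measure.pi fun j => (ProbabilityTheory.poissonMeasure (μ (B j))).map (Nat.cast : ℕ → ℝ) := by
  have hF : Measurable fun (κ : Measure Ω) j => (κ (B j)).toReal :=
    measurable_pi_iff.2 fun j => (Measure.measurable_coe (hB j)).ennreal_toReal
  rw [← charFun_eq_pi_iff]
  intro t
  simp_rw [ProbabilityTheory.charFun_map_cast_poissonMeasure]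
  rw [charFun_apply, integral_map (by fun_prop) (by fun_prop), integral_map hF.aemeasurable
    (by fun_prop)]
  set h : Ω → ℂ := fun x => Complex.exp (∑ j, (B j).indicator (fun _ => (t j : ℂ)) x * Complex.I)
    with h_def
  have hh : ∀ x, h x = 1 + ∑ j, (B j).indicator (fun _ => Complex.exp (t j * Complex.I) - 1) x := by
    intro x
    by_cases hx : ∃ j, x ∈ B j
    · obtain ⟨j, hj⟩ := hx
      have hne : ∀ i, i ≠ j → x ∉ B i := fun i hi hxi =>
        Set.disjoint_left.1 (hd hi) hxi hj
      simp only [h_def]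
      rw [Finset.sum_eq_single j (fun i _ hi => by simp [hne i hi]) (by simp),
        Finset.sum_eq_single j (fun i _ hi => by simp [hne i hi]) (by simp)]
      simp [hj]
    · push Not at hx
      simp [h_def, hx]
  have hint : ∫ x, h x ∂(μ : Measure Ω) =
      (μ.mass : ℂ) + ∑ j, (μ (B j) : ℂ) * (Complex.exp (t j * Complex.I) - 1) := by
    simp_rw [hh]
    have hi : ∀ j, Integrable ((B j).indicator fun _ => Complex.exp (t j * Complex.I) - 1)
        (μ : Measure Ω) := fun j => (integrable_const _).indicator (hB j)
    rw [integral_add (integrable_const _) (integrable_finsetSum _ fun j _ => hi j),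
      integral_finsetSum _ fun j _ => hi j]
    congr 1
    · simp [FiniteMeasure.mass, Measure.real]
      rfl
    · refine Finset.sum_congr rfl fun j _ => ?_
      rw [integral_indicator_const _ (hB j)]
      simp [Measure.real]
      left
      rfl
  have hval : ∀ (k : ℕ) (x : Fin k → Ω),
      Complex.exp (inner ℝ (WithLp.toLp 2 fun j =>
        ((∑ i : Fin k, Measure.dirac (x i)) (B j)).toReal) t * Complex.I) = ∏ i, h (x i) := by
    intro k x
    rw [h_def, ← Complex.exp_sum, Finset.sum_comm]
    congr 1
    rw [PiLp.inner_apply, Complex.ofReal_sum, Finset.sum_mul]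
    refine Finset.sum_congr rfl fun j _ => ?_
    change ((inner ℝ ((∑ i : Fin k, Measure.dirac (x i)) (B j)).toReal (t j) : ℝ) : ℂ) * _ = _
    rw [Measure.finsetSum_apply, ENNReal.toReal_sum (fun i _ => measure_ne_top _ _)]
    simp only [RCLike.inner_apply, conj_trivial, Complex.ofReal_mul, Complex.ofReal_sum,
      Finset.mul_sum, Finset.sum_mul]
    refine Finset.sum_congr rfl fun i _ => ?_
    rw [Measure.dirac_apply' _ (hB j)]
    by_cases hx : x i ∈ B j <;> simp [hx]
  have hmeas : Measurable fun κ : Measure Ω => Complex.exp (inner ℝ (WithLp.toLp 2 fun j =>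
        (κ (B j)).toReal) t * Complex.I) :=
    (show Measurable fun y : ι → ℝ =>
      Complex.exp (inner ℝ (WithLp.toLp 2 y) t * Complex.I) by fun_prop).comp hF
  have hbd : Integrable (fun κ : Measure Ω => Complex.exp (inner ℝ (WithLp.toLp 2 fun j =>
        (κ (B j)).toReal) t * Complex.I)) (poissonLaw μ) :=
    Integrable.of_bound hmeas.aestronglyMeasurable 1
      (Filter.Eventually.of_forall fun κ => by rw [Complex.norm_exp_ofReal_mul_I])
  rw [poissonLaw] at hbd ⊢
  rw [integral_sum_measure hbd]
  have hterm : ∀ k : ℕ, ∫ κ : Measure Ω, Complex.exp (inner ℝ (WithLp.toLp 2 fun j =>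
        (κ (B j)).toReal) t * Complex.I)
        ∂(ENNReal.ofReal (Real.exp (-(μ.mass : ℝ)) / (k.factorial : ℝ)) •
      (Measure.pi fun _ : Fin k => (μ : Measure Ω)).map
        (fun x : Fin k → Ω => ∑ i : Fin k, Measure.dirac (x i))) =
      Complex.exp (-(μ.mass : ℂ)) * ((∫ x, h x ∂(μ : Measure Ω)) ^ k / (k.factorial : ℂ)) := by
    intro k
    rw [integral_smul_measure, integral_map (measurable_sum_dirac k).aemeasurable
      hmeas.aestronglyMeasurable]
    simp_rw [hval]
    rw [integral_fintype_prod_eq_pow, ENNReal.toReal_ofReal (by positivity)]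
    simp
    ring
  simp_rw [hterm]
  rw [tsum_mul_left, ← congrFun NormedSpace.exp_eq_tsum_div (∫ x, h x ∂(μ : Measure Ω)),
    ← Complex.exp_eq_exp_ℂ, ← Complex.exp_add, hint, ← Complex.exp_sum]
  congr 1
  ring

/-- The `τ`-topology (topology of setwise convergence) on the set of all finite measures on `Ω`:
the coarsest topology for which `μ ↦ μ B` is continuous for each measurable set `B`. -/
@[reducible] def tauTopology (Ω : Type*) [MeasurableSpace Ω] : TopologicalSpace (FiniteMeasure Ω) :=
  ⨅ B : {B : Set Ω // MeasurableSet B},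
    TopologicalSpace.induced (fun μ : FiniteMeasure Ω => μ (B : Set Ω)) inferInstance

/-- The closure in the `τ`-topology, in the space of all finite measures. -/
def tauClosure {Ω : Type*} [MeasurableSpace Ω] (Ψ : Set (FiniteMeasure Ω)) :
    Set (FiniteMeasure Ω) :=
  @closure _ (tauTopology Ω) Ψ

/-- `Ψ` is relatively compact in the `τ`-topology: its `τ`-closure is `τ`-compact. -/
def IsTauRelativelyCompact {Ω : Type*} [MeasurableSpace Ω] (Ψ : Set (FiniteMeasure Ω)) : Prop :=
  @IsCompact _ (tauTopology Ω) (tauClosure Ψ)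

/-- A (possibly randomized) test based on `n` realizations `κ₁, …, κₙ`: the value is the
probability of rejecting the hypothesis `H₀`. -/
structure PoissonTest (Ω : Type*) [MeasurableSpace Ω] (n : ℕ) where
  toFun : (Fin n → Measure Ω) → ℝ
  measurable : Measurable toFun
  nonneg : ∀ κ, 0 ≤ toFun κ
  le_one : ∀ κ, toFun κ ≤ 1

/-- The joint law of `n` independent realizations of the Poisson process with mean measure `μ`. -/
noncomputable def poissonSampleLaw {Ω : Type*} [MeasurableSpace Ω] (n : ℕ) (μ : FiniteMeasure Ω) :
    Measure (Fin n → Measure Ω) :=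
  Measure.pi fun _ : Fin n => poissonLaw μ

/-- `α(K)`, the supremum over `Θ₀` of the type I error probabilities. -/
noncomputable def typeIError {Ω : Type*} [MeasurableSpace Ω] {n : ℕ}
    (Θ₀ : Set (FiniteMeasure Ω)) (K : PoissonTest Ω n) : ℝ :=
  ⨆ μ : Θ₀, ∫ κ, K.toFun κ ∂(poissonSampleLaw n (μ : FiniteMeasure Ω))

/-- `β(K)`, the supremum over `Θ₁` of the type II error probabilities. -/
noncomputable def typeIIError {Ω : Type*} [MeasurableSpace Ω] {n : ℕ}
    (Θ₁ : Set (FiniteMeasure Ω)) (K : PoissonTest Ω n) : ℝ :=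
  ⨆ μ : Θ₁, ∫ κ, (1 - K.toFun κ) ∂(poissonSampleLaw n (μ : FiniteMeasure Ω))

/-- There are uniformly consistent tests: for every level `0 < a < 1` there is a sequence of tests
`Kₙ`, `n = 1, 2, …`, with `α(Kₙ) < a` for all `n` and `β(Kₙ) → 0`. -/
def Distinguishable {Ω : Type*} [MeasurableSpace Ω] (Θ₀ Θ₁ : Set (FiniteMeasure Ω)) : Prop :=
  ∀ a : ℝ, 0 < a → a < 1 → ∃ K : (n : ℕ) → PoissonTest Ω n,
    (∀ n, 1 ≤ n → typeIError Θ₀ (K n) < a) ∧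
      Tendsto (fun n => typeIIError Θ₁ (K n)) atTop (𝓝 0)

/-- `α(K) + β(K) ≥ 1` for every sample size and every test. -/
def Indistinguishable {Ω : Type*} [MeasurableSpace Ω] (Θ₀ Θ₁ : Set (FiniteMeasure Ω)) : Prop :=
  ∀ n : ℕ, 1 ≤ n → ∀ K : PoissonTest Ω n, 1 ≤ typeIError Θ₀ K + typeIIError Θ₁ K

/-! Part (i) rests on continuity of power functions. On a `τ`-compact set of mean measures, `μ ↦
E_μ[K]` is `τ`-continuous for every test `K`, so the bounds `E_μ[K] ≤ α` on `Θ₀` and `1 - E_μ[K] ≤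
β` on `Θ₁` pass to the closures; at a common point they add up to `α + β ≥ 1`. Continuity is
inherited from `μ` by its finite powers (`SetwiseContinuous.pi`), by the Poisson law as a uniformly
convergent series of images of such powers (`setwiseContinuous_poissonLaw`), and by integrals of
`[0,1]`-valued functions (`SetwiseContinuous.integral`). The crux is `SetwiseContinuous.prod`:
compactness yields uniform countable additivity, without which setwise continuity on rectangles
would not extend to the product σ-algebra.

Part (ii) rests on Chernoff bounds. Comparing the number of points in `B` with a threshold separates
`μ B ≤ a` from `μ B ≥ b`, when `a < b`, with exponentially small errors. Exponential separation is
stable under finite unions on either side, so each `μ` has a neighbourhood separated from the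
complement of any given neighbourhood of it, and compactness of one closure leaves finitely many
neighbourhoods to combine. -/

/-! ### Setwise continuous families over a compact parameter space. -/

/-- A family of measures that depends continuously on its parameter for setwise convergence. -/
def SetwiseContinuous {I X : Type*} [TopologicalSpace I] [MeasurableSpace X]
    (m : I → Measure X) : Prop :=
  ∀ A, MeasurableSet A → Continuous fun i => (m i).real A

namespace SetwiseContinuous

variable {I X Y : Type*} [TopologicalSpace I] [MeasurableSpace X] [MeasurableSpace Y]
  {m : I → Measure X} {m' : I → Measure Y}

theorem exists_mass_le [CompactSpace I] (hm : SetwiseContinuous m) :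
    ∃ M, 0 < M ∧ ∀ i, (m i).real Set.univ ≤ M := by
  obtain ⟨M, hM⟩ := (isCompact_range (hm Set.univ .univ)).bddAbove
  exact ⟨max M 1, by positivity, fun i => (hM ⟨i, rfl⟩).trans (le_max_left _ _)⟩

/-- Uniform countable additivity of a compact family. -/
theorem exists_forall_lt [CompactSpace I] [∀ i, IsFiniteMeasure (m i)] (hm : SetwiseContinuous m)
    {B : ℕ → Set X} (hB : ∀ j, MeasurableSet (B j)) (hanti : Antitone B) (hemp : ⋂ j, B j = ∅)
    {ε : ℝ} (hε : 0 < ε) : ∃ j, ∀ i, (m i).real (B j) < ε := by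
  -- Dini's theorem: continuous functions on a compact space decreasing pointwise to `0` converge
  -- uniformly.
  have h : TendstoUniformly (fun j i => (m i).real (B j)) (fun _ => 0) atTop := by
    refine Antitone.tendstoUniformly_of_forall_tendsto (fun j => hm _ (hB j))
      (fun j k hjk i => measureReal_mono (hanti hjk)) continuous_const fun i => ?_
    have := tendsto_measure_iInter_atTop (μ := m i) (fun j => (hB j).nullMeasurableSet) hanti
      ⟨0, measure_ne_top _ _⟩
    rw [hemp, measure_empty] at this
    simpa [measureReal_def, Function.comp_def] using (ENNReal.tendsto_toReal ENNReal.zero_ne_top).comp this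
  rw [Metric.tendstoUniformly_iff] at h
  obtain ⟨j, hj⟩ := (h ε hε).exists
  refine ⟨j, fun i => ?_⟩
  have := hj i
  rwa [dist_comm, Real.dist_0_eq_abs, abs_of_nonneg measureReal_nonneg] at this

/-- A uniformly countably additive family which is continuous on a generating `π`-system and in
total mass is continuous for setwise convergence. -/
theorem of_isPiSystem [∀ i, IsFiniteMeasure (m i)] {S : Set (Set X)}
    (hgen : ‹MeasurableSpace X› = MeasurableSpace.generateFrom S) (hS : IsPiSystem S)
    (huniv : Continuous fun i => (m i).real Set.univ)
    (hcont : ∀ A ∈ S, Continuous fun i => (m i).real A)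
    (huca : ∀ B : ℕ → Set X, (∀ j, MeasurableSet (B j)) → Antitone B → ⋂ j, B j = ∅ →
      ∀ ε : ℝ, 0 < ε → ∃ j, ∀ i, (m i).real (B j) < ε) :
    SetwiseContinuous m := by
  intro A hA
  induction A, hA using MeasurableSpace.induction_on_inter hgen hS with
  | empty => simpa using continuous_const
  | basic t ht => exact hcont t ht
  | compl t ht ih =>
    simp_rw [measureReal_compl ht]
    exact huniv.sub ih
  | iUnion f hd hf ih =>
    -- The tails `R n` decrease to `∅`, so `huca` makes the partial sums converge uniformly, and a
    -- uniform limit of continuous functions is continuous.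
    set R : ℕ → Set X := fun n => (⋃ j, f j) \ ⋃ j ∈ Finset.range n, f j with hR
    have hfin : ∀ n, MeasurableSet (⋃ j ∈ Finset.range n, f j) := fun n =>
      Finset.measurableSet_biUnion _ fun j _ => hf j
    have hRm : ∀ n, MeasurableSet (R n) := fun n => (MeasurableSet.iUnion hf).diff (hfin n)
    have hRa : Antitone R := fun a b hab => Set.sdiff_subset_sdiff_right
      (Set.biUnion_subset_biUnion_left (Finset.range_subset_range.2 hab))
    have hRe : ⋂ n, R n = ∅ := by
      refine Set.eq_empty_of_forall_notMem fun x hx => ?_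
      rw [Set.mem_iInter] at hx
      obtain ⟨j, hj⟩ := Set.mem_iUnion.1 (hx 0).1
      exact (hx (j + 1)).2 (Set.mem_biUnion (x := j) (by simp) hj)
    have hu : TendstoUniformly (fun n i => ∑ j ∈ Finset.range n, (m i).real (f j))
        (fun i => (m i).real (⋃ j, f j)) atTop := by
      rw [Metric.tendstoUniformly_iff]
      intro ε hε
      obtain ⟨N, hN⟩ := huca R hRm hRa hRe ε hε
      filter_upwards [eventually_ge_atTop N] with n hn i
      have h1 : (m i).real (⋃ j ∈ Finset.range n, f j) =
          ∑ j ∈ Finset.range n, (m i).real (f j) :=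
        measureReal_biUnion_finset (fun a _ b _ hab => hd hab) fun j _ => hf j
      have h2 : (m i).real (R n) = (m i).real (⋃ j, f j) -
          (m i).real (⋃ j ∈ Finset.range n, f j) :=
        measureReal_sdiff (Set.iUnion₂_subset fun j _ => Set.subset_iUnion f j) (hfin n)
      rw [Real.dist_eq, ← h1, ← h2, abs_of_nonneg measureReal_nonneg]
      exact (measureReal_mono (hRa hn)).trans_lt (hN i)
    exact hu.continuous (Eventually.frequently (Eventually.of_forall fun n =>
      continuous_finsetSum _ fun j _ => ih j))

theorem const (μ : Measure X) : SetwiseContinuous fun _ : I => μ :=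
  fun _ _ => continuous_const

theorem map (hm : SetwiseContinuous m) {f : X → Y} (hf : Measurable f) :
    SetwiseContinuous fun i => (m i).map f := by
  intro A hA
  simpa only [map_measureReal_apply hf hA] using hm _ (hf hA)

/-- Rectangles form a generating `π`-system on which continuity is clear; the work is uniform
countable additivity of the products. It follows by slicing: slices of `B j` are uniformly small
except over a set of base points that is itself uniformly small. -/
theorem prod [CompactSpace I] [∀ i, IsFiniteMeasure (m i)] [∀ i, IsFiniteMeasure (m' i)]
    (hm : SetwiseContinuous m) (hm' : SetwiseContinuous m') :
    SetwiseContinuous fun i => (m i).prod (m' i) := by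
  have hrect : ∀ (s : Set X) (t : Set Y), MeasurableSet s → MeasurableSet t →
      Continuous fun i => ((m i).prod (m' i)).real (s ×ˢ t) := fun s t hs ht => by
    simp_rw [measureReal_prod_prod]
    exact (hm s hs).mul (hm' t ht)
  refine of_isPiSystem generateFrom_prod.symm isPiSystem_prod ?_ ?_ ?_
  · simpa only [Set.univ_prod_univ] using hrect _ _ .univ .univ
  · rintro _ ⟨s, hs, t, ht, rfl⟩
    exact hrect s t hs ht
  intro B hB hanti hemp ε hε
  -- Arguing by contradiction leaves only countably many parameters `i k` to control, so that the
  -- exceptional set `E j` below is a countable union and hence measurable.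
  by_contra! hcon
  choose i hi using hcon
  obtain ⟨M, hM0, hM⟩ := hm.exists_mass_le
  obtain ⟨M', hM0', hM'⟩ := hm'.exists_mass_le
  obtain ⟨δ, hδ0, hδ⟩ : ∃ δ : ℝ, 0 < δ ∧ δ * M + M' * δ < ε :=
    ⟨ε / (2 * (M + M')), by positivity, by field_simp; nlinarith⟩
  set E : ℕ → Set X := fun j => ⋃ k, {x | δ < (m' (i k)).real (Prod.mk x ⁻¹' B j)} with hE
  have hmeas : ∀ k j, Measurable fun x => (m' (i k)).real (Prod.mk x ⁻¹' B j) := fun k j =>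
    (measurable_measure_prodMk_left (hB j)).ennreal_toReal
  have hEm : ∀ j, MeasurableSet (E j) := fun j =>
    MeasurableSet.iUnion fun k => measurableSet_lt measurable_const (hmeas k j)
  have hEa : Antitone E := fun a b hab => Set.iUnion_mono fun k x hx =>
    lt_of_lt_of_le hx (measureReal_mono (Set.preimage_mono (hanti hab)))
  -- For fixed `x` the slices decrease to `∅`, so uniform countable additivity of `m'` bounds them
  -- by `δ` for all parameters at once.
  have hEe : ⋂ j, E j = ∅ := by
    refine Set.eq_empty_of_forall_notMem fun x hx => ?_
    obtain ⟨j, hj⟩ := hm'.exists_forall_lt (B := fun j => Prod.mk x ⁻¹' B j)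
      (fun j => measurable_prodMk_left (hB j)) (fun a b hab => Set.preimage_mono (hanti hab))
      (by rw [← Set.preimage_iInter, hemp, Set.preimage_empty]) hδ0
    obtain ⟨k, hk⟩ := Set.mem_iUnion.1 (Set.mem_iInter.1 hx j)
    exact lt_asymm hk (hj (i k))
  obtain ⟨j, hj⟩ := hm.exists_forall_lt hEm hEa hEe hδ0
  refine absurd (hi j) (not_le.2 (lt_of_le_of_lt ?_ hδ))
  set a := i j with ha
  have hslice : ∀ x, (m' a).real (Prod.mk x ⁻¹' B j) ≤ δ + (E j).indicator (fun _ => M') x := by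
    intro x
    by_cases hx : x ∈ E j
    · rw [Set.indicator_of_mem hx]
      have := (measureReal_mono (μ := m' a) (Set.subset_univ (Prod.mk x ⁻¹' B j))).trans (hM' a)
      linarith
    · rw [Set.indicator_of_notMem hx, add_zero]
      by_contra! h
      exact hx (Set.mem_iUnion.2 ⟨j, h⟩)
  have hint : Integrable (fun x => δ + (E j).indicator (fun _ => M') x) (m a) :=
    (integrable_const _).add ((integrable_const _).indicator (hEm j))
  have heq : ((m a).prod (m' a)).real (B j) = ∫ x, (m' a).real (Prod.mk x ⁻¹' B j) ∂(m a) := by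
    rw [measureReal_def, Measure.prod_apply (hB j), integral_eq_lintegral_of_nonneg_ae
      (Eventually.of_forall fun _ => measureReal_nonneg) (hmeas j j).aestronglyMeasurable]
    congr 1
    refine lintegral_congr fun x => ?_
    rw [ofReal_measureReal]
  rw [heq]
  calc ∫ x, (m' a).real (Prod.mk x ⁻¹' B j) ∂(m a)
      ≤ ∫ x, (δ + (E j).indicator (fun _ => M') x) ∂(m a) :=
        integral_mono_of_nonneg (Eventually.of_forall fun _ => measureReal_nonneg) hint
          (Eventually.of_forall hslice)
    _ = (m a).real Set.univ * δ + (m a).real (E j) * M' := by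
        rw [integral_add (integrable_const _) ((integrable_const _).indicator (hEm j)),
          integral_indicator_const _ (hEm j)]
        simp
    _ ≤ δ * M + M' * δ := by
        nlinarith [hM a, hj a]

theorem pi [CompactSpace I] [∀ i, IsFiniteMeasure (m i)] (hm : SetwiseContinuous m) (n : ℕ) :
    SetwiseContinuous fun i => Measure.pi fun _ : Fin n => m i := by
  induction n with
  | zero =>
    have h : (fun i => Measure.pi fun _ : Fin 0 => m i) = fun _ => Measure.dirac isEmptyElim :=
      funext fun i => Measure.pi_of_empty _
    exact h ▸ const _
  | succ n ih =>
    have h : ∀ i, (Measure.pi fun _ : Fin (n + 1) => m i) =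
        ((m i).prod (Measure.pi fun _ : Fin n => m i)).map
          (MeasurableEquiv.piFinSuccAbove (fun _ => X) 0).symm := fun i =>
      ((measurePreserving_piFinSuccAbove (fun _ => m i) 0).symm).map_eq.symm
    simp_rw [h]
    exact (hm.prod ih).map (MeasurableEquiv.measurable _)

/-- The integral is the mass of the region under the graph for the product with Lebesgue measure on
`[0,1)`, which reduces the claim to `prod` with a constant second factor. -/
theorem integral [CompactSpace I] [∀ i, IsFiniteMeasure (m i)] (hm : SetwiseContinuous m)
    {f : X → ℝ} (hf : Measurable f) (h0 : ∀ x, 0 ≤ f x) (h1 : ∀ x, f x ≤ 1) :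
    Continuous fun i => ∫ x, f x ∂(m i) := by
  set lam : Measure ℝ := volume.restrict (Set.Ico 0 1)
  have hS : MeasurableSet {p : X × ℝ | p.2 < f p.1} :=
    measurableSet_lt measurable_snd (hf.comp measurable_fst)
  have h : ∀ i, ∫ x, f x ∂(m i) = ((m i).prod lam).real {p : X × ℝ | p.2 < f p.1} := fun i => by
    rw [measureReal_def, Measure.prod_apply hS, integral_eq_lintegral_of_nonneg_ae
      (Eventually.of_forall h0) hf.aestronglyMeasurable]
    congr 1
    refine lintegral_congr fun x => ?_
    change _ = lam (Set.Iio (f x))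
    rw [Measure.restrict_apply measurableSet_Iio, Set.inter_comm, Set.Ico_inter_Iio,
      min_eq_right (h1 x), Real.volume_Ico, sub_zero]
  simp_rw [h]
  exact hm.prod (const lam) _ hS

end SetwiseContinuous

/-! ### Continuity of the Poisson law in its mean measure. -/

theorem poissonLaw_real_apply {Ω : Type*} [MeasurableSpace Ω] (μ : FiniteMeasure Ω)
    {A : Set (Measure Ω)} (hA : MeasurableSet A) :
    (poissonLaw μ).real A = ∑' k : ℕ, Real.exp (-(μ.mass : ℝ)) / (k.factorial : ℝ) *
      (Measure.pi fun _ : Fin k => (μ : Measure Ω)).real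
        ((fun x : Fin k → Ω => ∑ i : Fin k, Measure.dirac (x i)) ⁻¹' A) := by
  have h : poissonLaw μ A ≠ ⊤ := measure_ne_top _ _
  rw [measureReal_def]
  rw [poissonLaw, Measure.sum_apply _ hA] at h ⊢
  rw [ENNReal.tsum_toReal_eq (ENNReal.ne_top_of_tsum_ne_top h)]
  refine tsum_congr fun k => ?_
  rw [Measure.smul_apply, Measure.map_apply (measurable_sum_dirac k) hA, smul_eq_mul,
    ENNReal.toReal_mul, ENNReal.toReal_ofReal (by positivity), measureReal_def]

theorem measureReal_pi_const_le {X : Type*} [MeasurableSpace X] {μ : Measure X} [IsFiniteMeasure μ]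
    {M : ℝ} (hM : μ.real Set.univ ≤ M) (k : ℕ) (A : Set (Fin k → X)) :
    (Measure.pi fun _ : Fin k => μ).real A ≤ M ^ k := by
  refine (measureReal_mono (Set.subset_univ _)).trans ?_
  rw [measureReal_def, Measure.pi_univ]
  simp only [Finset.prod_const, Finset.card_univ, Fintype.card_fin, ENNReal.toReal_pow]
  exact pow_le_pow_left₀ ENNReal.toReal_nonneg hM k

/-- Weierstrass test with majorant `M ^ k / k!`. -/
theorem continuous_tsum_exp_neg_div_factorial_mul {I : Type*} [TopologicalSpace I] {a : I → ℝ}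
    {b : ℕ → I → ℝ} {M : ℝ} (ha : Continuous a) (ha0 : ∀ i, 0 ≤ a i) (hb : ∀ k, Continuous (b k))
    (hb0 : ∀ k i, 0 ≤ b k i) (hbM : ∀ k i, b k i ≤ M ^ k) :
    Continuous fun i => ∑' k : ℕ, Real.exp (-a i) / (k.factorial : ℝ) * b k i := by
  refine continuous_tsum (fun k => ((Real.continuous_exp.comp ha.neg).div_const _).mul (hb k))
    (Real.summable_pow_div_factorial M) fun k i => ?_
  have h2 : Real.exp (-a i) ≤ 1 := Real.exp_le_one_iff.2 (neg_nonpos.2 (ha0 i))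
  have h3 : Real.exp (-a i) / (k.factorial : ℝ) ≤ 1 / (k.factorial : ℝ) :=
    div_le_div_of_nonneg_right h2 (Nat.cast_nonneg _)
  rw [Real.norm_of_nonneg (mul_nonneg (div_nonneg (Real.exp_nonneg _) (Nat.cast_nonneg _))
    (hb0 k i))]
  calc _ ≤ 1 / (k.factorial : ℝ) * M ^ k :=
        mul_le_mul h3 (hbM k i) (hb0 k i) (div_nonneg zero_le_one (Nat.cast_nonneg _))
    _ = _ := by ring

theorem setwiseContinuous_poissonLaw {I Ω : Type*} [TopologicalSpace I] [CompactSpace I]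
    [MeasurableSpace Ω] {m : I → FiniteMeasure Ω}
    (hm : SetwiseContinuous fun i => (m i : Measure Ω)) :
    SetwiseContinuous fun i => poissonLaw (m i) := by
  intro A hA
  obtain ⟨M, hM0, hM⟩ := hm.exists_mass_le
  have h := continuous_tsum_exp_neg_div_factorial_mul (M := M) (hm _ .univ)
    (fun i => measureReal_nonneg)
    (fun k => hm.pi k _ (measurable_sum_dirac k hA)) (fun k i => measureReal_nonneg)
    (fun k i => measureReal_pi_const_le (hM i) k _)
  exact h.congr fun i => (poissonLaw_real_apply (m i) hA).symm

instance {Ω : Type*} [MeasurableSpace Ω] (n : ℕ) (μ : FiniteMeasure Ω) :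
    IsProbabilityMeasure (poissonSampleLaw n μ) := by
  rw [poissonSampleLaw]; infer_instance

/-! ### Power functions and indistinguishability. -/

section Tests

variable {Ω : Type*} [MeasurableSpace Ω] {n : ℕ}

theorem continuous_tauTopology_apply {B : Set Ω} (hB : MeasurableSet B) :
    @Continuous _ _ (tauTopology Ω) _ fun μ : FiniteMeasure Ω => μ B :=
  continuous_iInf_dom (i := (⟨B, hB⟩ : {B : Set Ω // MeasurableSet B})) continuous_induced_dom

/-- On a `τ`-compact set the power function of a test is `τ`-continuous. -/
theorem continuousOn_integral_poissonTest {C : Set (FiniteMeasure Ω)}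
    (hC : @IsCompact _ (tauTopology Ω) C) (K : PoissonTest Ω n) :
    @ContinuousOn _ _ (tauTopology Ω) _ (fun μ => ∫ κ, K.toFun κ ∂(poissonSampleLaw n μ)) C := by
  let _ := tauTopology Ω
  have : CompactSpace C := isCompact_iff_compactSpace.1 hC
  rw [continuousOn_iff_continuous_domRestrict]
  have hm : SetwiseContinuous fun μ : C => ((μ : FiniteMeasure Ω) : Measure Ω) := fun B hB =>
    NNReal.continuous_coe.comp ((continuous_tauTopology_apply hB).comp continuous_subtype_val)
  exact ((setwiseContinuous_poissonLaw hm).pi n).integral K.measurable K.nonneg K.le_one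

theorem integrable_poissonTest (K : PoissonTest Ω n) (μ : FiniteMeasure Ω) :
    Integrable K.toFun (poissonSampleLaw n μ) :=
  Integrable.of_bound K.measurable.aestronglyMeasurable 1 (Eventually.of_forall fun κ => by
    rw [Real.norm_of_nonneg (K.nonneg κ)]; exact K.le_one κ)

theorem integral_one_sub_poissonTest (K : PoissonTest Ω n) (μ : FiniteMeasure Ω) :
    ∫ κ, (1 - K.toFun κ) ∂(poissonSampleLaw n μ) = 1 - ∫ κ, K.toFun κ ∂(poissonSampleLaw n μ) := by
  rw [integral_sub (integrable_const _) (integrable_poissonTest K μ)]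
  simp

theorem integral_poissonTest_nonneg (K : PoissonTest Ω n) (μ : FiniteMeasure Ω) :
    0 ≤ ∫ κ, K.toFun κ ∂(poissonSampleLaw n μ) :=
  integral_nonneg K.nonneg

theorem integral_poissonTest_le_one (K : PoissonTest Ω n) (μ : FiniteMeasure Ω) :
    ∫ κ, K.toFun κ ∂(poissonSampleLaw n μ) ≤ 1 := by
  have : 0 ≤ ∫ κ, (1 - K.toFun κ) ∂(poissonSampleLaw n μ) :=
    integral_nonneg fun κ => sub_nonneg.2 (K.le_one κ)
  rw [integral_one_sub_poissonTest] at this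
  linarith

theorem le_typeIError {Θ₀ : Set (FiniteMeasure Ω)} (K : PoissonTest Ω n) {μ : FiniteMeasure Ω}
    (hμ : μ ∈ Θ₀) : ∫ κ, K.toFun κ ∂(poissonSampleLaw n μ) ≤ typeIError Θ₀ K := by
  refine le_ciSup (f := fun μ : Θ₀ => ∫ κ, K.toFun κ ∂(poissonSampleLaw n (μ : FiniteMeasure Ω)))
    ⟨1, ?_⟩ ⟨μ, hμ⟩
  rintro _ ⟨ν, rfl⟩
  exact integral_poissonTest_le_one K ν

theorem le_typeIIError {Θ₁ : Set (FiniteMeasure Ω)} (K : PoissonTest Ω n) {μ : FiniteMeasure Ω}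
    (hμ : μ ∈ Θ₁) : 1 - ∫ κ, K.toFun κ ∂(poissonSampleLaw n μ) ≤ typeIIError Θ₁ K := by
  rw [← integral_one_sub_poissonTest]
  refine le_ciSup (f := fun μ : Θ₁ => ∫ κ, (1 - K.toFun κ)
    ∂(poissonSampleLaw n (μ : FiniteMeasure Ω))) ⟨1, ?_⟩ ⟨μ, hμ⟩
  rintro _ ⟨ν, rfl⟩
  have := integral_poissonTest_nonneg K ν
  simp only [integral_one_sub_poissonTest]
  linarith

theorem indistinguishable_of_nonempty_inter {Θ₀ Θ₁ : Set (FiniteMeasure Ω)}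
    (h₀ : IsTauRelativelyCompact Θ₀) (h₁ : IsTauRelativelyCompact Θ₁)
    (h : (tauClosure Θ₀ ∩ tauClosure Θ₁).Nonempty) : Indistinguishable Θ₀ Θ₁ := by
  let _ := tauTopology Ω
  intro n _ K
  obtain ⟨μ, hμ₀, hμ₁⟩ := h
  have c₀ := continuousOn_integral_poissonTest h₀ K
  have c₁ := continuousOn_integral_poissonTest h₁ K
  have e₀ : ∫ κ, K.toFun κ ∂(poissonSampleLaw n μ) ≤ typeIError Θ₀ K :=
    closure_minimal (s := (fun μ => ∫ κ, K.toFun κ ∂(poissonSampleLaw n μ)) '' Θ₀)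
      (by rintro _ ⟨ν, hν, rfl⟩; exact le_typeIError K hν) isClosed_Iic
      (c₀.image_closure ⟨μ, hμ₀, rfl⟩)
  have e₁ : 1 - typeIIError Θ₁ K ≤ ∫ κ, K.toFun κ ∂(poissonSampleLaw n μ) :=
    closure_minimal (s := (fun μ => ∫ κ, K.toFun κ ∂(poissonSampleLaw n μ)) '' Θ₁)
      (by rintro _ ⟨ν, hν, rfl⟩; have := le_typeIIError K hν; simp only [Set.mem_Ici]; linarith)
      isClosed_Ici (c₁.image_closure ⟨μ, hμ₁, rfl⟩)
  linarith

end Tests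

/-! ### Chernoff bounds for Poisson counts. -/

theorem integral_exp_mul_poissonMeasure (r : NNReal) (t : ℝ) :
    Integrable (fun x => Real.exp (t * x))
      ((ProbabilityTheory.poissonMeasure r).map (Nat.cast : ℕ → ℝ)) ∧
    ∫ x, Real.exp (t * x) ∂((ProbabilityTheory.poissonMeasure r).map (Nat.cast : ℕ → ℝ)) =
      Real.exp (r * (Real.exp t - 1)) := by
  have hterm : ∀ n : ℕ, Real.exp (-r) * r ^ n / n.factorial * Real.exp (t * n) =
      Real.exp (-r) * ((r * Real.exp t) ^ n / n.factorial) := fun n => by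
    rw [mul_comm t, Real.exp_nat_mul, mul_pow]
    ring
  have hsum : HasSum (fun n : ℕ => Real.exp (-r) * ((r * Real.exp t) ^ n / n.factorial))
      (Real.exp (r * (Real.exp t - 1))) := by
    have := (NormedSpace.expSeries_div_hasSum_exp (r * Real.exp t)).mul_left (Real.exp (-r))
    rw [← Real.exp_eq_exp_ℝ, ← Real.exp_add] at this
    rwa [show -(r : ℝ) + r * Real.exp t = r * (Real.exp t - 1) by ring] at this
  constructor
  · rw [integrable_map_measure (by fun_prop) .of_discrete,
      ProbabilityTheory.integrable_poissonMeasure_iff]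
    simpa [Real.norm_eq_abs, hterm] using hsum.summable
  · rw [integral_map .of_discrete (by fun_prop), ProbabilityTheory.integral_poissonMeasure]
    simp_rw [smul_eq_mul, hterm]
    exact hsum.tsum_eq

/-- This provides a positive Chernoff exponent. With `t = d * r`, the quantity is `d ^ 2 * r - a *
(exp t - 1 - t)`, whose error term is quadratic in `t`. The sign of `t` selects the upper or the
lower tail. -/
theorem exists_mul_sub_exp_pos {a m : ℝ} (h : a ≠ m) :
    ∃ t : ℝ, 0 < t * (m - a) ∧ 0 < t * m - a * (Real.exp t - 1) := by
  set d := m - a with hd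
  have hd0 : 0 < d ^ 2 := by have : d ≠ 0 := sub_ne_zero.2 h.symm; positivity
  -- `|a| * r ≤ 1 / 2` keeps the error below half of the main term; `|d| * r ≤ 1` is the range in
  -- which `|exp x - 1 - x| ≤ x ^ 2` is available.
  set r : ℝ := 1 / (2 * (|a| + 1) * (|d| + 1)) with hr
  have hr0 : 0 < r := by positivity
  have hra : |a| * r ≤ 1 / 2 := by
    rw [hr, mul_one_div, div_le_iff₀ (by positivity)]
    nlinarith [abs_nonneg a, abs_nonneg d, mul_nonneg (abs_nonneg a) (abs_nonneg d)]
  have hrd : |d| * r ≤ 1 := by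
    rw [hr, mul_one_div, div_le_iff₀ (by positivity)]
    nlinarith [abs_nonneg a, abs_nonneg d, mul_nonneg (abs_nonneg a) (abs_nonneg d)]
  have hexp := Real.abs_exp_sub_one_sub_id_le (x := d * r) (by rwa [abs_mul, abs_of_pos hr0])
  have h1 : a * (Real.exp (d * r) - 1 - d * r) ≤ |a| * (d * r) ^ 2 :=
    (le_abs_self _).trans (by rw [abs_mul]; gcongr)
  have h2 : |a| * (d * r) ^ 2 ≤ 1 / 2 * (d ^ 2 * r) := by
    calc |a| * (d * r) ^ 2 = |a| * r * (d ^ 2 * r) := by ring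
      _ ≤ _ := by gcongr
  have h3 : 0 < d ^ 2 * r := by positivity
  have hm : m = a + d := by rw [hd]; ring
  refine ⟨d * r, by nlinarith, ?_⟩
  rw [hm]
  nlinarith

section Tests

variable {Ω : Type*} [MeasurableSpace Ω] {n : ℕ}

theorem map_toReal_apply_poissonLaw (μ : FiniteMeasure Ω) {B : Set Ω} (hB : MeasurableSet B) :
    (poissonLaw μ).map (fun κ => (κ B).toReal) =
      (ProbabilityTheory.poissonMeasure (μ B)).map (Nat.cast : ℕ → ℝ) := by
  have h := congrArg (Measure.map fun x : Unit → ℝ => x ())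
    (map_count_poissonLaw μ (fun _ : Unit => B) (fun _ => hB) (Subsingleton.pairwise))
  rw [Measure.map_map (by fun_prop) (measurable_pi_iff.2 fun _ =>
    (Measure.measurable_coe hB).ennreal_toReal)] at h
  have : ∀ j : Unit, IsProbabilityMeasure
      ((ProbabilityTheory.poissonMeasure (μ B)).map (Nat.cast : ℕ → ℝ)) := fun _ =>
    Measure.isProbabilityMeasure_map .of_discrete
  exact h.trans (measurePreserving_eval _ ()).map_eq

theorem integral_exp_mul_poissonLaw (μ : FiniteMeasure Ω) {B : Set Ω} (hB : MeasurableSet B)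
    (t : ℝ) :
    Integrable (fun κ : Measure Ω => Real.exp (t * (κ B).toReal)) (poissonLaw μ) ∧
    ∫ κ, Real.exp (t * (κ B).toReal) ∂(poissonLaw μ) =
      Real.exp (μ B * (Real.exp t - 1)) := by
  have hm : AEMeasurable (fun κ : Measure Ω => (κ B).toReal) (poissonLaw μ) :=
    (Measure.measurable_coe hB).ennreal_toReal.aemeasurable
  have h := integral_exp_mul_poissonMeasure (μ B) t
  rw [← map_toReal_apply_poissonLaw μ hB, integrable_map_measure (by fun_prop) hm,
    integral_map hm (by fun_prop)] at h
  exact h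

theorem measurable_sum_count {B : Set Ω} (hB : MeasurableSet B) :
    Measurable fun κ : Fin n → Measure Ω => ∑ i, (κ i B).toReal :=
  Finset.measurable_sum _ fun i _ =>
    ((Measure.measurable_coe hB).comp (measurable_pi_apply i)).ennreal_toReal

/-- Chernoff bound for the number of points of the sample in `B`. -/
theorem poissonSampleLaw_real_le_exp (μ : FiniteMeasure Ω) {B : Set Ω} (hB : MeasurableSet B)
    (t m : ℝ) :
    (poissonSampleLaw n μ).real {κ | t * (n * m) ≤ t * ∑ i, (κ i B).toReal} ≤
      Real.exp (-(n * (t * m - μ B * (Real.exp t - 1)))) := by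
  obtain ⟨hi, he⟩ := integral_exp_mul_poissonLaw μ hB t
  have hprod : ∀ κ : Fin n → Measure Ω, Real.exp (t * ∑ i, (κ i B).toReal) =
      ∏ i, Real.exp (t * (κ i B).toReal) := fun κ => by
    rw [Finset.mul_sum, Real.exp_sum]
  have hint : Integrable (fun κ : Fin n → Measure Ω => Real.exp (t * ∑ i, (κ i B).toReal))
      (poissonSampleLaw n μ) := by
    simp_rw [hprod]
    exact Integrable.fintype_prod fun _ => hi
  have hval : ∫ κ : Fin n → Measure Ω, Real.exp (t * ∑ i, (κ i B).toReal)
      ∂(poissonSampleLaw n μ) = Real.exp (n * (μ B * (Real.exp t - 1))) := by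
    simp_rw [hprod]
    rw [poissonSampleLaw, integral_fintype_prod_eq_pow
      (fun κ : Measure Ω => Real.exp (t * (κ B).toReal)), he, Fintype.card_fin, ← Real.exp_nat_mul]
  have hmarkov := mul_meas_ge_le_integral_of_nonneg
    (Eventually.of_forall fun κ : Fin n → Measure Ω => (Real.exp_pos _).le) hint
    (Real.exp (t * (n * m)))
  simp only [Real.exp_le_exp, hval] at hmarkov
  rw [← le_div_iff₀' (Real.exp_pos _), ← Real.exp_sub] at hmarkov
  refine hmarkov.trans (Real.exp_le_exp.2 (le_of_eq ?_))
  ring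

/-- The factor `m - a` treats both tails at once: if `a < m`, the means are at most `a` and the
count is at least `n * m`; if `m < a`, both inequalities are reversed. The rate is uniform in `μ`
because `μ B = a` is the worst case. -/
theorem exists_chernoff {B : Set Ω} (hB : MeasurableSet B) {a m : ℝ} (h : a ≠ m) :
    ∃ c : ℝ, 0 < c ∧ ∀ (n : ℕ) (μ : FiniteMeasure Ω), 0 ≤ (a - μ B) * (m - a) →
      (poissonSampleLaw n μ).real
        {κ | 0 ≤ (∑ i, (κ i B).toReal - n * m) * (m - a)} ≤ Real.exp (-c * n) := by
  obtain ⟨t, ht, hc⟩ := exists_mul_sub_exp_pos h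
  refine ⟨_, hc, fun n μ hμ => ?_⟩
  have hset : {κ : Fin n → Measure Ω | 0 ≤ (∑ i, (κ i B).toReal - n * m) * (m - a)} ⊆
      {κ | t * (n * m) ≤ t * ∑ i, (κ i B).toReal} := by
    intro κ hκ
    simp only [Set.mem_ofPred_eq] at hκ ⊢
    rcases pos_and_pos_or_neg_and_neg_of_mul_pos ht with ⟨h1, h2⟩ | ⟨h1, h2⟩
    · nlinarith [nonneg_of_mul_nonneg_left hκ h2]
    · nlinarith [nonpos_of_mul_nonneg_left hκ h2]
  refine (measureReal_mono hset).trans ((poissonSampleLaw_real_le_exp μ hB t m).trans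
    (Real.exp_le_exp.2 ?_))
  have hle : (μ B : ℝ) * (Real.exp t - 1) ≤ a * (Real.exp t - 1) := by
    rcases pos_and_pos_or_neg_and_neg_of_mul_pos ht with ⟨h1, h2⟩ | ⟨h1, h2⟩
    · have := Real.one_le_exp h1.le
      nlinarith [nonneg_of_mul_nonneg_left hμ h2]
    · have := Real.exp_le_one_iff.2 h1.le
      nlinarith [nonpos_of_mul_nonneg_left hμ h2]
  nlinarith [(Nat.cast_nonneg n : (0 : ℝ) ≤ n)]

/-! ### Exponentially separated hypotheses and distinguishability. -/

/-- There are tests of `A₀` against `A₁` both of whose error probabilities decay exponentially. -/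
def ExpSeparated (A₀ A₁ : Set (FiniteMeasure Ω)) : Prop :=
  ∃ (K : (n : ℕ) → PoissonTest Ω n) (c : ℝ) (n₀ : ℕ), 0 < c ∧ ∀ n : ℕ, n₀ < n →
    (∀ μ ∈ A₀, ∫ κ, (K n).toFun κ ∂(poissonSampleLaw n μ) ≤ Real.exp (-c * n)) ∧
    ∀ μ ∈ A₁, 1 - ∫ κ, (K n).toFun κ ∂(poissonSampleLaw n μ) ≤ Real.exp (-c * n)

/-- The test that rejects with constant probability `p`. -/
def PoissonTest.const (Ω : Type*) [MeasurableSpace Ω] (n : ℕ) (p : ℝ) (h0 : 0 ≤ p) (h1 : p ≤ 1) :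
    PoissonTest Ω n :=
  ⟨fun _ => p, measurable_const, fun _ => h0, fun _ => h1⟩

/-- The test with acceptance and rejection exchanged. -/
def PoissonTest.compl (K : PoissonTest Ω n) : PoissonTest Ω n :=
  ⟨fun κ => 1 - K.toFun κ, measurable_const.sub K.measurable, fun κ => sub_nonneg.2 (K.le_one κ),
    fun κ => sub_le_self _ (K.nonneg κ)⟩

/-- The larger of two tests. -/
def PoissonTest.max (K L : PoissonTest Ω n) : PoissonTest Ω n :=
  ⟨fun κ => Max.max (K.toFun κ) (L.toFun κ), K.measurable.max L.measurable,
    fun κ => (K.nonneg κ).trans (le_max_left _ _), fun κ => max_le (K.le_one κ) (L.le_one κ)⟩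

/-- The nonrandomized test with rejection region `S`. -/
noncomputable def PoissonTest.indicator (S : Set (Fin n → Measure Ω)) (hS : MeasurableSet S) :
    PoissonTest Ω n :=
  ⟨S.indicator fun _ => 1, measurable_const.indicator hS,
    fun κ => Set.indicator_nonneg (fun _ _ => zero_le_one) κ,
    fun κ => Set.indicator_le_self' (fun _ _ => zero_le_one) κ⟩

namespace ExpSeparated

variable {A₀ A₁ B₀ B₁ : Set (FiniteMeasure Ω)}

theorem mono (h : ExpSeparated A₀ A₁) (h₀ : B₀ ⊆ A₀) (h₁ : B₁ ⊆ A₁) : ExpSeparated B₀ B₁ := by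
  obtain ⟨K, c, n₀, hc, hK⟩ := h
  exact ⟨K, c, n₀, hc, fun n hn => ⟨fun μ hμ => (hK n hn).1 μ (h₀ hμ),
    fun μ hμ => (hK n hn).2 μ (h₁ hμ)⟩⟩

theorem symm (h : ExpSeparated A₀ A₁) : ExpSeparated A₁ A₀ := by
  obtain ⟨K, c, n₀, hc, hK⟩ := h
  refine ⟨fun n => (K n).compl, c, n₀, hc, fun n hn => ⟨fun μ hμ => ?_, fun μ hμ => ?_⟩⟩
  · simpa only [PoissonTest.compl, integral_one_sub_poissonTest] using (hK n hn).2 μ hμ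
  · simpa only [PoissonTest.compl, integral_one_sub_poissonTest, sub_sub_cancel] using
      (hK n hn).1 μ hμ

theorem empty_right : ExpSeparated A₀ ∅ :=
  ⟨fun n => PoissonTest.const Ω n 0 le_rfl zero_le_one, 1, 0, one_pos, fun n _ =>
    ⟨fun μ _ => by simpa [PoissonTest.const] using Real.exp_nonneg _, by simp⟩⟩

/-- For the larger of the two tests the type I errors at most add, while the type II error on each
piece does not increase. Halving the rate absorbs the resulting factor `2` once `n > 2 * log 2 / e`.
-/
theorem union_right (h : ExpSeparated A₀ A₁) (h' : ExpSeparated A₀ B₁) :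
    ExpSeparated A₀ (A₁ ∪ B₁) := by
  obtain ⟨K, c, n₀, hc, hK⟩ := h
  obtain ⟨L, d, n₁, hd, hL⟩ := h'
  set e := min c d with he
  have he0 : 0 < e := lt_min hc hd
  obtain ⟨n₂, hn₂⟩ := exists_nat_gt (2 * Real.log 2 / e)
  refine ⟨fun n => (K n).max (L n), e / 2, max (max n₀ n₁) n₂, by positivity, fun n hn => ?_⟩
  simp only [max_lt_iff] at hn
  obtain ⟨⟨hn0, hn1⟩, hn2⟩ := hn
  have hn2' : (n₂ : ℝ) < n := Nat.cast_lt.2 hn2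
  have hnpos : (0 : ℝ) ≤ n := Nat.cast_nonneg n
  have hce : Real.exp (-c * n) ≤ Real.exp (-e * n) :=
    Real.exp_le_exp.2 (by nlinarith [min_le_left c d])
  have hde : Real.exp (-d * n) ≤ Real.exp (-e * n) :=
    Real.exp_le_exp.2 (by nlinarith [min_le_right c d])
  have htwo : 2 * Real.exp (-e * n) ≤ Real.exp (-(e / 2) * n) := by
    nth_rewrite 1 [← Real.exp_log (two_pos : (0 : ℝ) < 2)]
    rw [← Real.exp_add, Real.exp_le_exp]
    have := (div_lt_iff₀ he0).1 (hn₂.trans hn2')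
    nlinarith
  have hpos := Real.exp_pos (-e * n)
  refine ⟨fun μ hμ => ?_, ?_⟩
  · have hle : ∫ κ, ((K n).max (L n)).toFun κ ∂(poissonSampleLaw n μ) ≤
        ∫ κ, ((K n).toFun κ + (L n).toFun κ) ∂(poissonSampleLaw n μ) :=
      integral_mono (integrable_poissonTest _ μ)
        ((integrable_poissonTest _ μ).add (integrable_poissonTest _ μ)) fun κ =>
          max_le_add_of_nonneg ((K n).nonneg κ) ((L n).nonneg κ)
    rw [integral_add (integrable_poissonTest _ μ) (integrable_poissonTest _ μ)] at hle
    have h1 := (hK n hn0).1 μ hμ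
    have h2 := (hL n hn1).1 μ hμ
    linarith
  · rintro μ (hμ | hμ)
    · have hle : ∫ κ, (K n).toFun κ ∂(poissonSampleLaw n μ) ≤
          ∫ κ, ((K n).max (L n)).toFun κ ∂(poissonSampleLaw n μ) :=
        integral_mono (integrable_poissonTest _ μ) (integrable_poissonTest _ μ) fun κ =>
          le_max_left _ _
      have h1 := (hK n hn0).2 μ hμ
      linarith
    · have hle : ∫ κ, (L n).toFun κ ∂(poissonSampleLaw n μ) ≤
          ∫ κ, ((K n).max (L n)).toFun κ ∂(poissonSampleLaw n μ) :=
        integral_mono (integrable_poissonTest _ μ) (integrable_poissonTest _ μ) fun κ =>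
          le_max_right _ _
      have h1 := (hL n hn1).2 μ hμ
      linarith

theorem union_left (h : ExpSeparated A₀ A₁) (h' : ExpSeparated B₀ A₁) :
    ExpSeparated (A₀ ∪ B₀) A₁ :=
  (h.symm.union_right h'.symm).symm

/-- The test rejects when the average count in `B` reaches the midpoint of `a` and `b`; each error
is then one Chernoff tail. -/
theorem setOf_le_setOf_ge {B : Set Ω} (hB : MeasurableSet B) {a b : ℝ} (hab : a < b) :
    ExpSeparated {μ | (μ B : ℝ) ≤ a} {μ | b ≤ (μ B : ℝ)} := by
  set m := (a + b) / 2 with hm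
  have ham : a < m := by linarith
  have hmb : m < b := by linarith
  obtain ⟨c, hc, hK⟩ := exists_chernoff hB ham.ne
  obtain ⟨d, hd, hL⟩ := exists_chernoff hB hmb.ne'
  have hS : ∀ n : ℕ, MeasurableSet {κ : Fin n → Measure Ω | n * m ≤ ∑ i, (κ i B).toReal} :=
    fun n => measurableSet_le measurable_const (measurable_sum_count hB)
  have hint : ∀ (n : ℕ) (μ : FiniteMeasure Ω), ∫ κ, (PoissonTest.indicator _ (hS n)).toFun κ
      ∂(poissonSampleLaw n μ) = (poissonSampleLaw n μ).real
        {κ : Fin n → Measure Ω | n * m ≤ ∑ i, (κ i B).toReal} := fun n μ => by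
    simp only [PoissonTest.indicator]
    rw [integral_indicator_const _ (hS n)]
    simp
  refine ⟨fun n => PoissonTest.indicator _ (hS n), min c d, 0, lt_min hc hd, fun n _ =>
    ⟨fun μ hμ => ?_, fun μ hμ => ?_⟩⟩
  · rw [hint]
    refine (measureReal_mono fun κ hκ => ?_).trans ((hK n μ ?_).trans (Real.exp_le_exp.2 ?_))
    · exact mul_nonneg (sub_nonneg.2 hκ) (sub_nonneg.2 ham.le)
    · exact mul_nonneg (sub_nonneg.2 hμ) (sub_nonneg.2 ham.le)
    · nlinarith [min_le_left c d, (Nat.cast_nonneg n : (0 : ℝ) ≤ n)]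
  · rw [hint, ← probReal_compl_eq_one_sub (hS n)]
    have hcompl : ∀ κ : Fin n → Measure Ω, κ ∈ {κ : Fin n → Measure Ω |
        n * m ≤ ∑ i, (κ i B).toReal}ᶜ → ∑ i, (κ i B).toReal ≤ n * m := fun κ hκ => by
      rw [Set.mem_compl_iff, Set.mem_ofPred_eq, not_le] at hκ
      exact hκ.le
    refine (measureReal_mono fun κ hκ => ?_).trans ((hL n μ ?_).trans (Real.exp_le_exp.2 ?_))
    · exact mul_nonneg_of_nonpos_of_nonpos (sub_nonpos.2 (hcompl κ hκ)) (sub_nonpos.2 hmb.le)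
    · exact mul_nonneg_of_nonpos_of_nonpos (sub_nonpos.2 hμ) (sub_nonpos.2 hmb.le)
    · nlinarith [min_le_right c d, (Nat.cast_nonneg n : (0 : ℝ) ≤ n)]

/-- Every measure has a `τ`-neighbourhood which can be separated from the complement of a given
`τ`-neighbourhood. -/
theorem exists_mem_nhds (μ : FiniteMeasure Ω) {U : Set (FiniteMeasure Ω)}
    (hU : U ∈ @nhds _ (tauTopology Ω) μ) :
    ∃ V ∈ @nhds _ (tauTopology Ω) μ, ExpSeparated V Uᶜ := by
  let _ := tauTopology Ω
  -- The sets `U` with the desired property form a filter, intersections being handled by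
  -- `union_right`. Since the `τ`-neighbourhood filter is an infimum, it suffices to treat
  -- neighbourhoods given by a single `B`.
  let F : Filter (FiniteMeasure Ω) :=
    { sets := {U | ∃ V ∈ 𝓝 μ, ExpSeparated V Uᶜ}
      univ_sets := ⟨Set.univ, univ_mem, by simpa using empty_right⟩
      sets_of_superset := fun {U W} ⟨V, hV, h⟩ hUW =>
        ⟨V, hV, h.mono subset_rfl (Set.compl_subset_compl.2 hUW)⟩
      inter_sets := fun {U U'} ⟨V, hV, h⟩ ⟨V', hV', h'⟩ => ⟨V ∩ V', inter_mem hV hV', by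
        rw [Set.compl_inter]
        exact (h.mono Set.inter_subset_left subset_rfl).union_right
          (h'.mono Set.inter_subset_right subset_rfl)⟩ }
  suffices hF : F ≤ 𝓝 μ from hF hU
  rw [nhds_iInf]
  refine le_iInf fun ⟨B, hB⟩ => ?_
  rw [nhds_induced]
  rintro U ⟨W, hW, hWU⟩
  obtain ⟨ε, hε, hball⟩ := Metric.mem_nhds_iff.1 hW
  have hcont : Continuous fun ν : FiniteMeasure Ω => (ν B : ℝ) :=
    NNReal.continuous_coe.comp (continuous_tauTopology_apply hB)
  -- Half the radius leaves a gap of `ε / 2` on each side; outside `U` the mass of `B` lies beyond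
  -- one of the two gaps.
  refine ⟨{ν | (ν B : ℝ) ∈ Set.Icc (μ B - ε / 2 : ℝ) (μ B + ε / 2)},
    hcont.continuousAt (Icc_mem_nhds (by linarith) (by linarith)), ?_⟩
  have h1 := setOf_le_setOf_ge hB (show (μ B + ε / 2 : ℝ) < μ B + ε by linarith)
  have h2 := (setOf_le_setOf_ge hB (show (μ B - ε : ℝ) < μ B - ε / 2 by linarith)).symm
  refine ((h1.mono (fun ν hν => hν.2) subset_rfl).union_right
    (h2.mono (fun ν hν => hν.1) subset_rfl)).mono subset_rfl fun ν hν => ?_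
  by_contra! hcon
  simp only [Set.mem_union, Set.mem_ofPred_eq, not_or, not_le] at hcon
  refine hν (hWU (hball ?_))
  rw [Metric.mem_ball, NNReal.dist_eq, abs_lt]
  constructor <;> linarith [hcon.1, hcon.2]

/-- Compactness induction: each point of the closure has a neighbourhood separated from `A₁`, since
the closure of `A₁` misses that point, and `union_left` combines finitely many of them. -/
theorem of_isTauRelativelyCompact (h₀ : IsTauRelativelyCompact A₀)
    (h : tauClosure A₀ ∩ tauClosure A₁ = ∅) : ExpSeparated A₀ A₁ := by
  let _ := tauTopology Ω
  suffices hs : ExpSeparated (tauClosure A₀) A₁ from hs.mono subset_closure subset_rfl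
  refine IsCompact.induction_on (p := fun s => ExpSeparated s A₁) h₀ empty_right.symm
    (fun s t hst ht => ht.mono hst subset_rfl) (fun s t hs ht => hs.union_left ht) fun μ hμ => ?_
  have hU : (tauClosure A₁)ᶜ ∈ 𝓝 μ :=
    isClosed_closure.isOpen_compl.mem_nhds fun hμ' => (h ▸ ⟨hμ, hμ'⟩ : μ ∈ (∅ : Set _))
  obtain ⟨V, hV, hVU⟩ := exists_mem_nhds μ hU
  refine ⟨V, mem_nhdsWithin_of_mem_nhds hV, hVU.mono subset_rfl ?_⟩
  rw [compl_compl]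
  exact subset_closure

theorem exists_typeIError_le (h : ExpSeparated A₀ A₁) :
    ∃ (K : (n : ℕ) → PoissonTest Ω n) (c : ℝ) (n₀ : ℕ), 0 < c ∧ ∀ n : ℕ, n₀ < n →
      typeIError A₀ (K n) ≤ Real.exp (-c * n) ∧ typeIIError A₁ (K n) ≤ Real.exp (-c * n) := by
  obtain ⟨K, c, n₀, hc, hK⟩ := h
  -- `Real.iSup_le` also asks that the bound be nonnegative, which covers an empty hypothesis, whose
  -- supremum is `0`.
  refine ⟨K, c, n₀, hc, fun n hn => ⟨Real.iSup_le (fun μ => (hK n hn).1 μ μ.2)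
    (Real.exp_nonneg _), Real.iSup_le (fun μ => ?_) (Real.exp_nonneg _)⟩⟩
  rw [integral_one_sub_poissonTest]
  exact (hK n hn).2 μ μ.2

theorem distinguishable (h : ExpSeparated A₀ A₁) : Distinguishable A₀ A₁ := by
  obtain ⟨K, c, n₀, hc, hK⟩ := h.exists_typeIError_le
  intro a ha _
  have hlim : Tendsto (fun n : ℕ => Real.exp (-c * n)) atTop (𝓝 0) :=
    Real.tendsto_exp_atBot.comp
      ((tendsto_natCast_atTop_atTop).const_mul_atTop_of_neg (neg_lt_zero.2 hc))
  obtain ⟨n₁, hn₁⟩ := eventually_atTop.1 (hlim.eventually (gt_mem_nhds ha))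
  -- For the finitely many `n` at which the exponential bound is unavailable or not below `a`, the
  -- test that never rejects has type I error `0`.
  refine ⟨fun n => if n₀ < n ∧ n₁ ≤ n then K n else PoissonTest.const Ω n 0 le_rfl zero_le_one,
    fun n _ => ?_, ?_⟩
  · by_cases hn : n₀ < n ∧ n₁ ≤ n
    · simpa only [if_pos hn] using (hK n hn.1).1.trans_lt (hn₁ n hn.2)
    · simpa [if_neg hn, typeIError, PoissonTest.const] using ha
  · refine squeeze_zero' (Eventually.of_forall fun n => Real.iSup_nonneg fun μ =>
      integral_nonneg fun κ => sub_nonneg.2 (PoissonTest.le_one _ κ)) ?_ hlim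
    filter_upwards [eventually_gt_atTop n₀, eventually_ge_atTop n₁] with n h0 h1
    simpa only [if_pos (And.intro h0 h1)] using (hK n h0).2

end ExpSeparated

end Tests

theorem theorem2p9 {Ω : Type*} [TopologicalSpace Ω] [T2Space Ω] [MeasurableSpace Ω] [BorelSpace Ω]
    (Θ₀ Θ₁ : Set (FiniteMeasure Ω)) :
    (IsTauRelativelyCompact Θ₀ → IsTauRelativelyCompact Θ₁ →
      (tauClosure Θ₀ ∩ tauClosure Θ₁).Nonempty → Indistinguishable Θ₀ Θ₁) ∧
    ((IsTauRelativelyCompact Θ₀ ∨ IsTauRelativelyCompact Θ₁) →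
      tauClosure Θ₀ ∩ tauClosure Θ₁ = ∅ →
        Distinguishable Θ₀ Θ₁ ∧
        ∃ (K : (n : ℕ) → PoissonTest Ω n) (c : ℝ) (n₀ : ℕ), 0 < c ∧ ∀ n : ℕ, n₀ < n →
          typeIError Θ₀ (K n) ≤ Real.exp (-c * n) ∧ typeIIError Θ₁ (K n) ≤ Real.exp (-c * n)) := by
  refine ⟨indistinguishable_of_nonempty_inter, fun hc hd => ?_⟩
  -- Separation is symmetric, so it does not matter which hypothesis is relatively compact.
  have h : ExpSeparated Θ₀ Θ₁ := hc.elim (fun h => .of_isTauRelativelyCompact h hd) fun h =>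
    (ExpSeparated.of_isTauRelativelyCompact h (by rwa [Set.inter_comm])).symm
  exact ⟨h.distinguishable, h.exists_typeIError_le⟩
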